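/- **Conventions.** Fix a primitive recursive encoding $\langle\cdot\rangle:\bigcup_{k}\mathbb N^k\to\mathbb N$ of finite sequences: it is injective, its range is primitive recursive, it is primitive recursive on each $\mathbb N^k$, $\langle x_0,\dots,x_{k-1}\rangle>x_i$ for all $i$, and length, appending an element and projection to the $i$-th entry are primitive recursive on codes. Fix a standard Gödel numbering of the partial recursive functions $\mathbb N\rightharpoonup\mathbb N$. * A code of $q\in\mathbb Q$ is a number $\langle s,a,d\rangle$ with $d\ne0$ and $q=(-1)^s a/d$. * A code of a computable real $\alpha$ is a Gödel number of a total recursive function $k\mapsto\langle s(k),a(k),d(k)\rangle$, with $s,a,d:\mathbb N\to\mathbb N$ recursive, $d(k)\neq 0$ and $|\alpha-(-1)^{s(k)}a(k)/d(k)|<2^{-k}$ for all $k$. * A discrete memoryless channel (DMC) with input alphabet $[M]=\{1,\dots,M\}$ and output alphabet $[N]$, $M,N\ge1$, is a stochastic matrix $H_{xy}=p_{Y|X}(y\mid x)$. If all $H_{xy}$ are computable, an encoding of it is any number $\langle r_1,\dots,r_M\rangle$ with $r_x=\langle c_{x1},\dots,c_{xN}\rangle$, where $c_{xy}$ is a code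 of $H_{xy}$. Its capacity is $C(p_{Y|X})=\sup_{p_X} I(X;Y)$, in bits. * An $(m,n)$ block code is a pair $\mathcal C=(E,D)$ of functions $E:[m]\to[M]^n$, $D:[N]^n\to[m]$; its rate is $\frac{\log_2 m}{n}$ and its maximum block error probability is $$\lambda_{\max}(\mathcal C,p_{Y|X})=\max_{w\in[m]}\ \sum_{y\in[N]^n:\,D(y)\neq w}\ \prod_{i=1}^n p_{Y|X}\bigl(y_i\mid E(w)_i\bigr).$$ Its encoding is $\langle\langle e_1,\dots,e_m\rangle,\langle D(\bar y_1),\dots,D(\bar y_{N^n})\rangle\rangle$, where $e_w=\langle E(w)_1,\dots,E(w)_n\rangle$ and $\bar y_1,\dots,\bar y_{N^n}$ is the lexicographic enumeration of $[N]^n$. **Theorem.** There is a $\mu$-recursive partial function $\mathrm{FindCode}:\mathbb N^3\rightharpoonup\mathbb N$, which is also computed by a Turing machine (with a finite state set and a finite tape alphabet, natural numbers being written on the tape in binary; the machine halts exactly on the domain of $\mathrm{FindCode}$), with the following property. Let $p_{Y|X}$ be any DMC, with input and output alphabets of any sizes, whose transition probabilities are computable reals, let $R$ be rational with $0<R<C(p_{Y|X})$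 and let $\epsilon>0$ be rational. If $c_H$ is any encoding of $p_{Y|X}$, $c_R$ any code of $R$ and $c_\epsilon$ any code of $\epsilon$, then $\mathrm{FindCode}(c_H,c_R,c_\epsilon)$ is defined, and for some $n\ge1$ it is the encoding of a $(\lceil 2^{nR}\rceil,n)$ block code $\mathcal C$ for $p_{Y|X}$ with rate at least $R$ and $\lambda_{\max}(\mathcal C,p_{Y|X})<\epsilon$. -/

import Mathlib

namespace ChannelCoding

noncomputable section

/-! ### Encodings of finite sequences, rationals and computable reals -/

/-- `code` is a primitive recursive encoding `⟨x₀, …, xₙ₋₁⟩` of finite sequences of natural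
numbers by natural numbers. -/
structure IsPrimrecEncoding (code : List ℕ → ℕ) : Prop where
  /-- The encoding is injective. -/
  injective : Function.Injective code
  /-- Being the code of a sequence is a primitive recursive relation. -/
  seq : PrimrecPred (fun u : ℕ => ∃ l : List ℕ, code l = u)
  /-- For each fixed length the encoding is primitive recursive. -/
  tuple : ∀ n : ℕ, Nat.Primrec' (fun v : List.Vector ℕ n => code v.toList)
  /-- The code of a sequence is larger than all its entries. -/
  lt_code : ∀ (l : List ℕ) (x : ℕ), x ∈ l → x < code l
  /-- The length is primitive recursive. -/
  lh : ∃ lh : ℕ → ℕ, Primrec lh ∧ ∀ l : List ℕ, lh (code l) = l.length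
  /-- Appending an element is primitive recursive. -/
  app : ∃ app : ℕ → ℕ → ℕ, Primrec₂ app ∧
    ∀ (l : List ℕ) (y : ℕ), app (code l) y = code (l ++ [y])
  /-- The projections are primitive recursive. -/
  proj : ∃ proj : ℕ → ℕ → ℕ, Primrec₂ proj ∧
    ∀ (l : List ℕ) (i : ℕ) (hi : i < l.length), proj (code l) i = l[i]

/-- `u` is a code of the rational number `q`: `u = ⟨s, a, d⟩` with `d ≠ 0` and
`q = (-1)^s * a / d`. -/
def IsRatCode (code : List ℕ → ℕ) (q : ℚ) (u : ℕ) : Prop :=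
  ∃ s a d : ℕ, d ≠ 0 ∧ u = code [s, a, d] ∧ q = (-1 : ℚ) ^ s * ((a : ℚ) / (d : ℚ))

/-- The universal partial recursive function of one variable: `universal e n` is the value at `n`
of the partial recursive function with Gödel number `e`. -/
def universal (e : ℕ) : ℕ →. ℕ :=
  (Denumerable.ofNat Nat.Partrec.Code e).eval

/-- `u` is a code of the computable real number `α`: it is a Gödel number of a (total) recursive
function `n ↦ ⟨s n, a n, d n⟩` whose values encode rational numbers at distance less than
`1 / 2 ^ n` from `α`. -/
def IsRealCode (code : List ℕ → ℕ) (α : ℝ) (u : ℕ) : Prop :=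
  ∃ s a d : ℕ → ℕ, Computable s ∧ Computable a ∧ Computable d ∧ (∀ n, d n ≠ 0) ∧
    (∀ n, |α - (-1 : ℝ) ^ s n * ((a n : ℝ) / (d n : ℝ))| < 1 / 2 ^ n) ∧
    ∀ n, universal u n = Part.some (code [s n, a n, d n])

/-! ### Discrete memoryless channels -/

/-- A discrete memoryless channel with input alphabet `Fin M` and output alphabet `Fin N`, given
by its transition probabilities `prob x y = p(y | x)`. -/
structure DMC (M N : ℕ) where
  prob : Fin M → Fin N → ℝ
  nonneg : ∀ x y, 0 ≤ prob x y
  sum_eq_one : ∀ x, ∑ y, prob x y = 1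

namespace DMC

variable {M N : ℕ} (H : DMC M N)

/-- The mutual information (in bits) between the input and the output of the channel when the
input has distribution `p`. Terms with `prob x y = 0` vanish, as usual. -/
def mutualInfo (p : Fin M → ℝ) : ℝ :=
  ∑ x, ∑ y, p x * H.prob x y * Real.logb 2 (H.prob x y / ∑ x', p x' * H.prob x' y)

/-- The channel capacity (in bits per channel use): the supremum of the mutual information over
all input distributions. -/
def capacity : ℝ :=
  sSup (H.mutualInfo '' stdSimplex ℝ (Fin M))

/-- The transition probability `p(y₁ … yₙ | x₁ … xₙ)` of `n` uses of the channel. -/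
def wordProb {n : ℕ} (x : Fin n → Fin M) (y : Fin n → Fin N) : ℝ :=
  ∏ i, H.prob (x i) (y i)

/-- `u` encodes the channel `H`: it is the code of the sequence of the codes of the rows of `H`,
where each entry of a row is represented by some code of it as a computable real. -/
def IsCode (code : List ℕ → ℕ) (u : ℕ) : Prop :=
  ∃ c : Fin M → Fin N → ℕ, (∀ x y, IsRealCode code (H.prob x y) (c x y)) ∧
    u = code (List.ofFn fun x => code (List.ofFn fun y => c x y))

end DMC

/-! ### Block codes -/

/-- An `(m, n)` block code with messages `Fin m`, input alphabet `Fin M` and output alphabet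
`Fin N`. -/
structure BlockCode (M N m n : ℕ) where
  /-- the encoding function -/
  enc : Fin m → Fin n → Fin M
  /-- the decoding function -/
  dec : (Fin n → Fin N) → Fin m

/-- The `k`-th word of length `n` over `Fin N` in lexicographic order (`k = 0, …, N ^ n - 1`): its
letters are the base-`N` digits of `k`, the most significant one first. -/
def lexWord {N n : ℕ} (k : Fin (N ^ n)) : Fin n → Fin N :=
  fun i => finFunctionFinEquiv.symm k i.rev

namespace BlockCode

variable {M N m n : ℕ} (C : BlockCode M N m n)

/-- The rate `log₂ m / n`. -/
def rate (_C : BlockCode M N m n) : ℝ :=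
  Real.logb 2 m / n

/-- The probability that message `w` is decoded incorrectly. -/
def blockError (H : DMC M N) (w : Fin m) : ℝ :=
  ∑ y with C.dec y ≠ w, H.wordProb (C.enc w) y

/-- The maximum block error probability over all messages. -/
def maxBlockError (H : DMC M N) : ℝ :=
  ⨆ w : Fin m, C.blockError H w

/-- The code of the encoding function: the sequence of codewords. Letters and messages are
numbered from `1`, whence the `+ 1` here and below. -/
def encNumber (code : List ℕ → ℕ) : ℕ :=
  code (List.ofFn fun w : Fin m => code (List.ofFn fun i : Fin n => (C.enc w i : ℕ) + 1))

/-- The code of the decoding function: the sequence of its values at all words of length `n` in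
lexicographic order. -/
def decNumber (code : List ℕ → ℕ) : ℕ :=
  code (List.ofFn fun k : Fin (N ^ n) => (C.dec (lexWord k) : ℕ) + 1)

/-- The code of a block code. -/
def number (code : List ℕ → ℕ) : ℕ :=
  code [C.encNumber code, C.decNumber code]

end BlockCode

/-! ### Functions computed by Turing machines -/

/-- The word `#b₀#b₁…#bₖ₋₁` representing a tuple `(x₀, …, xₖ₋₁)`, where `bᵢ` is the binary
expansion of `xᵢ`, the most significant bit first (it is empty for `xᵢ = 0`). The separator `#` is
`none`, and the bits are `some true` and `some false`. -/
def tapeWord (l : List ℕ) : List (Option Bool) :=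
  l.flatMap fun x => none :: (Nat.bits x).reverse.map some

/-- The partial function `f : ℕᵏ ⇀ ℕ` is computed by a Turing machine with one two-way infinite
tape, finitely many states (type `Q`) and finite tape alphabet `Γ`, in which the symbols `#`, `0`,
`1` are represented by three distinct non-blank symbols. Started in its initial state on the tape
containing the representation of `v` and otherwise blank, with the head on the first symbol, the
machine halts if and only if `f v` is defined, and then the final tape contains the representation
of `f v` and is otherwise blank, with the head on the first symbol. -/
def IsTuringComputable {k : ℕ} (f : List.Vector ℕ k →. ℕ) : Prop :=
  ∃ (Γ Q : Type) (_ : Finite Γ) (_ : Finite Q) (_ : Inhabited Γ) (_ : Inhabited Q)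
    (ι : Option Bool → Γ) (T : Turing.TM0.Machine Γ Q),
    Function.Injective ι ∧ (∀ a, ι a ≠ default) ∧
    ∀ v : List.Vector ℕ k,
      (StateTransition.eval (Turing.TM0.step T)
        (Turing.TM0.init ((tapeWord v.toList).map ι))).map (fun c => c.Tape) =
      (f v).map (fun y => Turing.Tape.mk₁ ((tapeWord [y]).map ι))

end

end ChannelCoding

namespace ChannelCoding

noncomputable section

/-! ### The channel coding theorem -/

/-! The algorithm searches for a block code together with a certificate. It tests tuples `(f, k, n,
u)`: `u` must encode a block code of length `n` with `⌈2^(nR)⌉` messages, and integer upper bounds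
of `2^k` times the transition probabilities, found within `f` steps of computation, must already
force all error probabilities below `ε`. The test is primitive recursive, so the search is partial
recursive. The bounds are valid for all `f` and `k` (`blockError_le`), hence every answer is
correct, and only termination is at stake.

Termination rests on Shannon's theorem (`exists_blockCode_lt`). Take an input distribution `p` and
`γ` with `R < γ < I(p)`, and let `B x` be the set of outputs with information density above `nγ`. A
Chernoff bound makes the complement of `B x` exponentially unlikely on average over `x`, while `B x`
has output probability at most `2^(-nγ)`; Feinstein's greedy choice of codewords then succeeds for
about `2^(nR)` messages. The resulting error is strictly below `ε` and the computed bounds converge,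
so some `f` and `k` certify it (`exists_errorBound_lt`).

For the Turing machine, the partial recursive function is compiled to a machine with four stacks and
then to one tape. What remains is to match the tape formats: a mark at the stack bottom, and the
order of the arguments. -/

/-- **Feinstein's lemma.** -/
theorem exists_disjoint_decoding_sets {X Y : Type*} [Fintype X] [Fintype Y] [DecidableEq Y]
    {p : X → ℝ} (hp : ∀ x, 0 ≤ p x) (hp1 : ∑ x, p x = 1)
    {W : X → Y → ℝ} (hW : ∀ x y, 0 ≤ W x y) (B : X → Finset Y) {c : ℝ} (hc : 0 ≤ c)
    (hB : ∀ x, ∑ y ∈ B x, ∑ x', p x' * W x' y ≤ c) {ε : ℝ} (m : ℕ)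
    (h : ∑ x, p x * ∑ y ∈ (B x)ᶜ, W x y + m * c ≤ ε) :
    ∃ (E : Fin m → X) (D : Fin m → Finset Y), Pairwise (fun i j => Disjoint (D i) (D j)) ∧
      ∀ w, D w ⊆ B (E w) ∧ ∑ y ∈ (D w)ᶜ, W (E w) y ≤ ε := by
  induction m with
  | zero => exact ⟨Fin.elim0, Fin.elim0, fun i => i.elim0, fun w => w.elim0⟩
  | succ m ih =>
    push_cast at h
    obtain ⟨E, D, hD, hED⟩ := ih (by linarith)
    set U : Finset Y := Finset.univ.biUnion D with hU
    -- The inclusions `D w ⊆ B (E w)` are carried through the induction for this bound: the region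
    -- already used has output probability at most `m * c`.
    have hqU : ∑ y ∈ U, ∑ x', p x' * W x' y ≤ m * c := by
      calc ∑ y ∈ U, ∑ x', p x' * W x' y
          = ∑ w, ∑ y ∈ D w, ∑ x', p x' * W x' y :=
            Finset.sum_biUnion fun i _ j _ hij => hD hij
        _ ≤ ∑ _w : Fin m, c := Finset.sum_le_sum fun w _ =>
            (Finset.sum_le_sum_of_subset_of_nonneg (hED w).1 fun y _ _ =>
              Finset.sum_nonneg fun x' _ => mul_nonneg (hp _) (hW _ _)).trans (hB _)
        _ = m * c := by simp
    have hswap : ∑ x, p x * ∑ y ∈ U, W x y ≤ m * c := by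
      rw [Finset.sum_comm] at hqU
      simpa [Finset.mul_sum] using hqU
    have havg : ∑ x, p x * ∑ y ∈ (B x \ U)ᶜ, W x y ≤ ε := by
      calc ∑ x, p x * ∑ y ∈ (B x \ U)ᶜ, W x y
          ≤ ∑ x, (p x * ∑ y ∈ (B x)ᶜ, W x y + p x * ∑ y ∈ U, W x y) := by
            refine Finset.sum_le_sum fun x _ => ?_
            rw [← mul_add]
            refine mul_le_mul_of_nonneg_left ?_ (hp x)
            rw [← Finset.sum_union_inter]
            refine (Finset.sum_le_sum_of_subset_of_nonneg ?_ fun y _ _ => hW x y).trans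
              (le_add_of_nonneg_right (Finset.sum_nonneg fun y _ => hW x y))
            intro y
            simp only [Finset.mem_compl, Finset.mem_sdiff, Finset.mem_union]
            tauto
        _ ≤ ε := by rw [Finset.sum_add_distrib]; linarith
    -- Some input is no worse than the average; it becomes the next codeword, with decoding set `B x
    -- \ U`.
    obtain ⟨x, hx⟩ : ∃ x, ∑ y ∈ (B x \ U)ᶜ, W x y ≤ ε := by
      by_contra! hcon
      have hlt : ∑ x, p x * ε < ∑ x, p x * ∑ y ∈ (B x \ U)ᶜ, W x y := by
        obtain ⟨x₀, -, hx₀⟩ : ∃ x ∈ Finset.univ, 0 < p x := by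
          by_contra! hnp
          have := Finset.sum_nonpos hnp
          linarith
        exact Finset.sum_lt_sum (fun x _ => mul_le_mul_of_nonneg_left (hcon x).le (hp x))
          ⟨x₀, Finset.mem_univ _, mul_lt_mul_of_pos_left (hcon x₀) hx₀⟩
      rw [← Finset.sum_mul, hp1, one_mul] at hlt
      linarith
    have hdisj : ∀ i, Disjoint (D i) (B x \ U) := fun i =>
      Finset.disjoint_left.2 fun y hy hy' =>
        (Finset.mem_sdiff.1 hy').2 (Finset.mem_biUnion.2 ⟨i, Finset.mem_univ _, hy⟩)
    refine ⟨Fin.snoc E x, Fin.snoc D (B x \ U), ?_, ?_⟩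
    · intro i j hij
      induction i using Fin.lastCases with
      | last =>
        induction j using Fin.lastCases with
        | last => exact absurd rfl hij
        | cast j => simpa using (hdisj j).symm
      | cast i =>
        induction j using Fin.lastCases with
        | last => simpa using hdisj i
        | cast j => simpa using hD (fun h => hij (by rw [h]))
    · intro w
      induction w using Fin.lastCases with
      | last => simpa [Finset.sdiff_subset] using hx
      | cast i => simpa using hED i

/-- A function with negative derivative at `0` takes smaller values at some positive points. -/
theorem exists_pos_lt_of_hasDerivAt_neg {f : ℝ → ℝ} {f' : ℝ} (hf : HasDerivAt f f' 0)
    (hf' : f' < 0) : ∃ s, 0 < s ∧ f s < f 0 := by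
  have h := (hasDerivAt_iff_tendsto_slope.1 hf).eventually_lt_const hf'
  have h2 : ∀ᶠ s in nhdsWithin (0 : ℝ) (Set.Ioi 0), slope f 0 s < 0 :=
    h.filter_mono (nhdsWithin_mono _ fun s hs => ne_of_gt hs)
  obtain ⟨s, hs, hs0⟩ := (h2.and self_mem_nhdsWithin).exists
  refine ⟨s, hs0, ?_⟩
  rw [slope_def_field, sub_zero] at hs
  have := (div_neg_iff.1 hs).resolve_left (fun h => absurd h.2 (not_lt.2 (le_of_lt hs0)))
  linarith [this.1]

/-! ### Exponential bounds for the information density -/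

namespace DMC

variable {M N : ℕ} (H : DMC M N)

/-- The distribution of the output when the input has distribution `p`. -/
def outProb (p : Fin M → ℝ) (y : Fin N) : ℝ := ∑ x, p x * H.prob x y

/-- The moment generating function of the information density, tilted by `a`. -/
def tilt (p : Fin M → ℝ) (a s : ℝ) : ℝ :=
  ∑ x, ∑ y, p x * H.prob x y * (a * H.outProb p y / H.prob x y) ^ s

variable {H} {p : Fin M → ℝ}

theorem outProb_nonneg (hp : ∀ x, 0 ≤ p x) (y : Fin N) : 0 ≤ H.outProb p y :=
  Finset.sum_nonneg fun x _ => mul_nonneg (hp x) (H.nonneg x y)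

theorem outProb_pos (hp : ∀ x, 0 ≤ p x) {x : Fin M} {y : Fin N} (h : p x * H.prob x y ≠ 0) :
    0 < H.outProb p y :=
  (lt_of_le_of_ne (mul_nonneg (hp x) (H.nonneg x y)) h.symm).trans_le
    (Finset.single_le_sum (f := fun x => p x * H.prob x y)
      (fun x _ => mul_nonneg (hp x) (H.nonneg x y)) (Finset.mem_univ x))

theorem sum_prob (hp1 : ∑ x, p x = 1) : ∑ x, ∑ y, p x * H.prob x y = 1 := by
  simp [← Finset.mul_sum, H.sum_eq_one, hp1]

/-- The tilted moment equals `1` at `s = 0`, and its derivative there is `log 2 * (γ - I(p)) < 0`.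
-/
theorem exists_tilt_lt_one (hp : ∀ x, 0 ≤ p x) (hp1 : ∑ x, p x = 1) {γ : ℝ}
    (hγ : γ < H.mutualInfo p) : ∃ s, 0 < s ∧ H.tilt p (2 ^ γ) s < 1 := by
  have h0 : H.tilt p (2 ^ γ) 0 = 1 := by simp [tilt, sum_prob hp1]
  have hlog2 : 0 < Real.log 2 := Real.log_pos one_lt_two
  have hd : HasDerivAt (H.tilt p (2 ^ γ))
      (∑ x, ∑ y, p x * H.prob x y * (Real.log 2 *
        (γ - Real.logb 2 (H.prob x y / ∑ x', p x' * H.prob x' y)))) 0 := by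
    unfold tilt
    refine HasDerivAt.fun_sum fun x _ => HasDerivAt.fun_sum fun y _ => ?_
    by_cases h : p x * H.prob x y = 0
    · simpa [h] using hasDerivAt_const (0 : ℝ) (0 : ℝ)
    have hq := outProb_pos hp h
    have hw : 0 < H.prob x y := lt_of_le_of_ne (H.nonneg x y) (right_ne_zero_of_mul h).symm
    have h2 : (0 : ℝ) < 2 ^ γ := Real.rpow_pos_of_pos two_pos _
    refine HasDerivAt.const_mul _ ?_
    have := (Real.hasStrictDerivAt_const_rpow (a := 2 ^ γ * H.outProb p y / H.prob x y)
      (by positivity) 0).hasDerivAt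
    refine this.congr_deriv ?_
    rw [Real.rpow_zero, one_mul, mul_div_assoc, Real.log_mul h2.ne' (by positivity),
      Real.log_rpow two_pos, Real.logb, Real.log_div hq.ne' hw.ne']
    change _ = Real.log 2 * (γ - Real.log (H.prob x y / H.outProb p y) / Real.log 2)
    rw [Real.log_div hw.ne' hq.ne']
    field_simp
    ring
  have hneg : (∑ x, ∑ y, p x * H.prob x y * (Real.log 2 *
        (γ - Real.logb 2 (H.prob x y / ∑ x', p x' * H.prob x' y)))) < 0 := by
    have : (∑ x, ∑ y, p x * H.prob x y * (Real.log 2 *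
        (γ - Real.logb 2 (H.prob x y / ∑ x', p x' * H.prob x' y)))) =
        Real.log 2 * (γ - H.mutualInfo p) := by
      rw [mul_sub, ← mul_one (Real.log 2 * γ), ← sum_prob (H := H) hp1, mutualInfo]
      simp only [Finset.mul_sum, ← Finset.sum_sub_distrib]
      exact Finset.sum_congr rfl fun x _ => Finset.sum_congr rfl fun y _ => by ring
    rw [this]
    exact mul_neg_of_pos_of_neg hlog2 (by linarith)
  obtain ⟨s, hs, hlt⟩ := exists_pos_lt_of_hasDerivAt_neg hd hneg
  exact ⟨s, hs, h0 ▸ hlt⟩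

theorem sum_prod_word {ι : Type*} [Fintype ι] (n : ℕ) (f : Fin n → ι → ℝ) :
    ∑ x : Fin n → ι, ∏ i, f i (x i) = ∏ i, ∑ a, f i a := by
  classical
  rw [Finset.prod_univ_sum, Fintype.piFinset_univ]

theorem wordProb_nonneg {n : ℕ} (x : Fin n → Fin M) (y : Fin n → Fin N) : 0 ≤ H.wordProb x y :=
  Finset.prod_nonneg fun _ _ => H.nonneg _ _

theorem sum_wordProb {n : ℕ} (x : Fin n → Fin M) : ∑ y, H.wordProb x y = 1 := by
  unfold wordProb
  rw [sum_prod_word n fun i b => H.prob (x i) b]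
  simp [H.sum_eq_one]

theorem sum_mul_wordProb {n : ℕ} (y : Fin n → Fin N) :
    ∑ x : Fin n → Fin M, (∏ i, p (x i)) * H.wordProb x y = ∏ i, H.outProb p (y i) := by
  simp only [wordProb, ← Finset.prod_mul_distrib, outProb]
  exact sum_prod_word n fun i a => p a * H.prob a (y i)

/-- Chernoff bound: on the event the ratio of `a ^ n * ∏ q(yᵢ)` to the word probability is at least
`1`, and so is its `s`-th power. The expectation of that power factors over the letters. -/
theorem prob_low_information_le (hp : ∀ x, 0 ≤ p x) {a s : ℝ} (ha : 0 < a) (hs : 0 < s) (n : ℕ) :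
    ∑ x : Fin n → Fin M, (∏ i, p (x i)) *
      ∑ y with ¬ a ^ n * ∏ i, H.outProb p (y i) < H.wordProb x y, H.wordProb x y ≤
      H.tilt p a s ^ n := by
  have htilt : H.tilt p a s ^ n = ∑ x : Fin n → Fin M, ∑ y : Fin n → Fin N,
      ∏ i, (p (x i) * H.prob (x i) (y i) * (a * H.outProb p (y i) / H.prob (x i) (y i)) ^ s) := by
    have : ∀ x : Fin n → Fin M, (∑ y : Fin n → Fin N, ∏ i, (p (x i) * H.prob (x i) (y i) *
        (a * H.outProb p (y i) / H.prob (x i) (y i)) ^ s)) = ∏ i, ∑ b, (p (x i) * H.prob (x i) b *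
        (a * H.outProb p b / H.prob (x i) b) ^ s) := fun x =>
      sum_prod_word n fun i b => p (x i) * H.prob (x i) b *
        (a * H.outProb p b / H.prob (x i) b) ^ s
    simp only [this]
    rw [sum_prod_word n fun _ c => ∑ b, (p c * H.prob c b *
        (a * H.outProb p b / H.prob c b) ^ s)]
    simp [tilt]
  rw [htilt]
  refine Finset.sum_le_sum fun x _ => ?_
  rw [Finset.mul_sum, Finset.sum_filter]
  refine Finset.sum_le_sum fun y _ => ?_
  have hbase : ∀ i, 0 ≤ a * H.outProb p (y i) / H.prob (x i) (y i) := fun i =>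
    div_nonneg (mul_nonneg ha.le (outProb_nonneg hp _)) (H.nonneg _ _)
  have hR : 0 ≤ ∏ i, (p (x i) * H.prob (x i) (y i) *
      (a * H.outProb p (y i) / H.prob (x i) (y i)) ^ s) :=
    Finset.prod_nonneg fun i _ => mul_nonneg (mul_nonneg (hp _) (H.nonneg _ _))
      (Real.rpow_nonneg (hbase i) _)
  split_ifs with h
  · exact hR
  · by_cases h0 : (∏ i, p (x i)) * H.wordProb x y = 0
    · rwa [h0]
    have hw : 0 < H.wordProb x y := lt_of_le_of_ne (wordProb_nonneg x y) (right_ne_zero_of_mul h0).symm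
    rw [Finset.prod_mul_distrib, Finset.prod_mul_distrib,
      Real.finsetProd_rpow _ _ fun i _ => hbase i, Finset.prod_div_distrib,
      Finset.prod_mul_distrib]
    refine le_mul_of_one_le_right
      (mul_nonneg (Finset.prod_nonneg fun i _ => hp _) (wordProb_nonneg x y)) ?_
    refine Real.one_le_rpow ?_ hs.le
    change 1 ≤ _ / H.wordProb x y
    rw [one_le_div hw]
    simpa using h

end DMC

/-- Feinstein's lemma for the words with information density above `n log₂ a`. On such a set the
output probability is below `a⁻ⁿ` times the conditional one, which gives `c = a⁻ⁿ`. -/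
theorem exists_blockCode_le {M N n m : ℕ} (H : DMC M N) {p : Fin M → ℝ} (hp : ∀ x, 0 ≤ p x)
    (hp1 : ∑ x, p x = 1) {a s ε : ℝ} (ha : 0 < a) (hs : 0 < s) (hm : 0 < m)
    (h : H.tilt p a s ^ n + m * (a⁻¹) ^ n ≤ ε) :
    ∃ C : BlockCode M N m n, C.maxBlockError H ≤ ε := by
  classical
  let B : (Fin n → Fin M) → Finset (Fin n → Fin N) := fun x =>
    {y | a ^ n * ∏ i, H.outProb p (y i) < H.wordProb x y}
  have hB : ∀ x, ∑ y ∈ B x, ∑ x' : Fin n → Fin M, (∏ i, p (x' i)) * H.wordProb x' y ≤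
      (a⁻¹) ^ n := by
    intro x
    calc ∑ y ∈ B x, ∑ x' : Fin n → Fin M, (∏ i, p (x' i)) * H.wordProb x' y
        ≤ ∑ y ∈ B x, (a⁻¹) ^ n * H.wordProb x y := by
          refine Finset.sum_le_sum fun y hy => ?_
          rw [DMC.sum_mul_wordProb, inv_pow, inv_mul_eq_div, le_div_iff₀ (pow_pos ha n), mul_comm]
          exact (Finset.mem_filter.1 hy).2.le
      _ ≤ ∑ y, (a⁻¹) ^ n * H.wordProb x y :=
          Finset.sum_le_sum_of_subset_of_nonneg (Finset.subset_univ _) fun y _ _ =>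
            mul_nonneg (by positivity) (DMC.wordProb_nonneg x y)
      _ = (a⁻¹) ^ n := by rw [← Finset.mul_sum, DMC.sum_wordProb, mul_one]
  obtain ⟨E, D, hD, hED⟩ := exists_disjoint_decoding_sets (p := fun x : Fin n → Fin M => ∏ i, p (x i))
    (fun x => Finset.prod_nonneg fun i _ => hp _)
    (by rw [DMC.sum_prod_word n fun _ => p]; simp [hp1])
    (W := fun x y => H.wordProb x y) (fun x y => DMC.wordProb_nonneg x y) B (c := (a⁻¹) ^ n)
    (by positivity) hB (ε := ε) m (by
      refine le_trans (add_le_add_left ?_ _) h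
      simpa [B, Finset.compl_filter] using DMC.prob_low_information_le (H := H) hp ha hs n)
  let C : BlockCode M N m n :=
    { enc := E
      -- Outputs outside all decoding sets may go to any message, since they are counted as errors
      -- in the bound anyway.
      dec := fun y => if h : ∃ w, y ∈ D w then h.choose else ⟨0, hm⟩ }
  have hdec : ∀ w y, y ∈ D w → C.dec y = w := by
    intro w y hy
    have hex : ∃ w, y ∈ D w := ⟨w, hy⟩
    have : C.dec y = hex.choose := dif_pos hex
    rw [this]
    by_contra hne
    exact Finset.disjoint_left.1 (hD hne) hex.choose_spec hy
  have : Nonempty (Fin m) := ⟨⟨0, hm⟩⟩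
  refine ⟨C, ciSup_le fun w => (Finset.sum_le_sum_of_subset_of_nonneg ?_ fun y _ _ =>
    DMC.wordProb_nonneg _ y).trans (hED w).2⟩
  intro y hy
  simp only [Finset.mem_filter, Finset.mem_univ, true_and, Finset.mem_compl] at hy ⊢
  exact fun h => hy (hdec w y h)

/-- **Shannon's channel coding theorem**, for the maximal error probability. -/
theorem exists_blockCode_lt {M N : ℕ} (hM : 0 < M) (H : DMC M N) {R ε : ℝ} (hR : 0 < R)
    (hRC : R < H.capacity) (hε : 0 < ε) :
    ∃ n : ℕ, 0 < n ∧ ∃ C : BlockCode M N ⌈(2 : ℝ) ^ ((n : ℝ) * R)⌉₊ n, C.maxBlockError H < ε := by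
  have hne : (H.mutualInfo '' stdSimplex ℝ (Fin M)).Nonempty :=
    ⟨_, Set.mem_image_of_mem _ (single_mem_stdSimplex ℝ (⟨0, hM⟩ : Fin M))⟩
  obtain ⟨_, ⟨p, hp, rfl⟩, hRp⟩ := exists_lt_of_lt_csSup hne hRC
  obtain ⟨γ, hRγ, hγ⟩ := exists_between hRp
  obtain ⟨s, hs, hlt⟩ := DMC.exists_tilt_lt_one hp.1 hp.2 hγ
  have htilt0 : 0 ≤ H.tilt p (2 ^ γ) s :=
    Finset.sum_nonneg fun x _ => Finset.sum_nonneg fun y _ =>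
      mul_nonneg (mul_nonneg (hp.1 x) (H.nonneg x y)) (Real.rpow_nonneg
        (div_nonneg (mul_nonneg (by positivity) (DMC.outProb_nonneg hp.1 y)) (H.nonneg x y)) _)
  have h1 := tendsto_pow_atTop_nhds_zero_of_lt_one htilt0 hlt
  have hb : (2 : ℝ) ^ (R - γ) < 1 := Real.rpow_lt_one_of_one_lt_of_neg one_lt_two (by linarith)
  have h2 := (tendsto_pow_atTop_nhds_zero_of_lt_one (by positivity) hb).const_mul 2
  have h12 := h1.add h2
  rw [mul_zero, add_zero] at h12
  obtain ⟨n, hn, hn0⟩ :=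
    ((h12.eventually_lt_const hε).and (Filter.eventually_gt_atTop 0)).exists
  -- The factor `2` absorbs the rounding: `⌈x⌉ ≤ x + 1 ≤ 2 * x` for `x ≥ 1`.
  have hm : (⌈(2 : ℝ) ^ ((n : ℝ) * R)⌉₊ : ℝ) * ((2 ^ γ)⁻¹) ^ n ≤ 2 * (2 ^ (R - γ)) ^ n := by
    have hone : (1 : ℝ) ≤ 2 ^ ((n : ℝ) * R) := Real.one_le_rpow one_le_two (by positivity)
    have hceil := (Nat.ceil_lt_add_one (zero_le_one.trans hone)).le
    have hpow : ((2 : ℝ) ^ (R - γ)) ^ n = 2 ^ ((n : ℝ) * R) * ((2 ^ γ)⁻¹) ^ n := by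
      rw [sub_eq_add_neg, Real.rpow_add two_pos, Real.rpow_neg two_pos.le, mul_pow, mul_comm (n : ℝ),
        Real.rpow_mul_natCast two_pos.le]
    rw [hpow, ← mul_assoc]
    exact mul_le_mul_of_nonneg_right (by linarith) (by positivity)
  obtain ⟨C, hC⟩ := exists_blockCode_le (n := n) (m := ⌈(2 : ℝ) ^ ((n : ℝ) * R)⌉₊) H hp.1 hp.2
    (a := 2 ^ γ) (s := s) (by positivity) hs (Nat.ceil_pos.2 (by positivity))
    (add_le_add_right hm _)
  exact ⟨n, hn0, C, hC.trans_lt hn⟩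

/-! ### Partial recursive functions are computed by Turing machines -/

open Turing StateTransition

/-! ### Adding a first and a last step to a Turing machine -/

section Bracket

variable {Γ : Type} [Inhabited Γ] {Λ : Type} [Inhabited Λ]

/-- The machine with states in `S` which applies `g` to the symbol under the head, runs `M` from
the state `q₀`, and applies `g'` to the symbol under the head when `M` halts. The state `none` is
the initial one and `some none` the final one. -/
def bracketMachine (g g' : Γ → Γ) (M : TM0.Machine Γ Λ) (S : Finset Λ) (q₀ : S) :
    TM0.Machine Γ (Option (Option S))
  | none, a => some (some (some q₀), TM0.Stmt.write (g a))
  | some none, _ => none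
  | some (some q), a =>
    open scoped Classical in
    match M q a with
    | none => some (some none, TM0.Stmt.write (g' a))
    -- The value `q₀` is a dummy: a supporting set `S` is closed under the transitions of `M`.
    | some (q', s) => some (some (some (if h : q' ∈ S then ⟨q', h⟩ else q₀)), s)

variable {g g' : Γ → Γ} {M : TM0.Machine Γ Λ} {S : Finset Λ} (q₀ : S)

theorem step_bracketMachine_of_none {q : Λ} {T : Tape Γ} (hq : q ∈ S)
    (h : TM0.step M ⟨q, T⟩ = none) :
    TM0.step (bracketMachine g g' M S q₀) ⟨some (some ⟨q, hq⟩), T⟩ =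
      some ⟨some none, T.write (g' T.head)⟩ := by
  have h' : M q T.head = none := by simpa [TM0.step] using h
  simp [TM0.step, bracketMachine, h']

theorem step_bracketMachine_of_some (hS : TM0.Supports M (S : Set Λ)) {q q' : Λ}
    {T T' : Tape Γ} (hq : q ∈ S) (h : TM0.step M ⟨q, T⟩ = some ⟨q', T'⟩) :
    ∃ hq' : q' ∈ S, TM0.step (bracketMachine g g' M S q₀) ⟨some (some ⟨q, hq⟩), T⟩ =
      some ⟨some (some ⟨q', hq'⟩), T'⟩ := by
  obtain ⟨⟨q₁, s⟩, h₁, h₂⟩ := Option.map_eq_some_iff.1 h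
  injection h₂ with h₂ h₃
  subst h₂
  have hq' : q₁ ∈ S := hS.2 h₁ hq
  refine ⟨hq', ?_⟩
  have h₁' : M q T.head = some (q₁, s) := h₁
  simp only [TM0.step, bracketMachine, h₁', hq', dif_pos, Option.map_some, ← h₃]

theorem mem_eval_bracketMachine (hS : TM0.Supports M (S : Set Λ)) {q : Λ} (hq : q ∈ S)
    {T : Tape Γ} {b : TM0.Cfg Γ (Option (Option S))} :
    b ∈ eval (TM0.step (bracketMachine g g' M S q₀)) ⟨some (some ⟨q, hq⟩), T⟩ ↔
      ∃ c ∈ eval (TM0.step M) ⟨q, T⟩, b = ⟨some none, c.Tape.write (g' c.Tape.head)⟩ := by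
  constructor
  · intro h
    refine evalInduction (C := fun a => ∀ q T, ∀ hq : q ∈ S,
      (⟨some (some ⟨q, hq⟩), T⟩ : TM0.Cfg Γ (Option (Option S))) = a →
      ∃ c ∈ eval (TM0.step M) ⟨q, T⟩, b = ⟨some none, c.Tape.write (g' c.Tape.head)⟩) h ?_
      q T hq rfl
    rintro _ h ih q T hq rfl
    rcases e : TM0.step M ⟨q, T⟩ with _ | ⟨q', T'⟩
    · refine ⟨⟨q, T⟩, mem_eval.2 ⟨.refl, e⟩, ?_⟩
      have hr := step_bracketMachine_of_none (g := g) (g' := g') q₀ hq e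
      rw [reaches_eval (Relation.ReflTransGen.single hr)] at h
      exact Part.mem_unique h (mem_eval.2 ⟨.refl, rfl⟩)
    · obtain ⟨hq', hs⟩ := step_bracketMachine_of_some (g := g) (g' := g') q₀ hS hq e
      obtain ⟨c, hc, hb⟩ := ih _ hs q' T' hq' rfl
      exact ⟨c, by rwa [reaches_eval (Relation.ReflTransGen.single e)], hb⟩
  · rintro ⟨c, hc, rfl⟩
    refine evalInduction (C := fun a => ∀ q T, ∀ hq : q ∈ S, (⟨q, T⟩ : TM0.Cfg Γ Λ) = a →
      (⟨some none, c.Tape.write (g' c.Tape.head)⟩ : TM0.Cfg Γ (Option (Option S))) ∈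
        eval (TM0.step (bracketMachine g g' M S q₀)) ⟨some (some ⟨q, hq⟩), T⟩) hc ?_ q T hq rfl
    rintro _ h ih q T hq rfl
    rcases e : TM0.step M ⟨q, T⟩ with _ | ⟨q', T'⟩
    · cases Part.mem_unique h (mem_eval.2 ⟨.refl, e⟩)
      exact mem_eval.2 ⟨Relation.ReflTransGen.single (step_bracketMachine_of_none q₀ hq e), rfl⟩
    · obtain ⟨hq', hs⟩ := step_bracketMachine_of_some (g := g) (g' := g') q₀ hS hq e
      rw [reaches_eval (Relation.ReflTransGen.single hs)]
      exact ih _ e q' T' hq' rfl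

end Bracket

/-! ### Emulation of stack machines on one tape -/

section TM2

variable {K : Type} {Γ : K → Type}
/-- Set the mark of the bottom in a symbol of the emulator of stack machines. -/
def setMark (b : Bool) (a : TM2to1.Γ' K Γ) : TM2to1.Γ' K Γ := (b, a.2)

/-- The tape symbol of the emulator of stack machines without the mark of the bottom. -/
def unmarked : PointedMap (∀ k, Option (Γ k)) (TM2to1.Γ' K Γ) := ⟨fun a => (false, a), rfl⟩

theorem addBottom_eq (L : ListBlank (∀ k, Option (Γ k))) : TM2to1.addBottom L =
    ListBlank.cons (setMark true (unmarked.f L.head)) (L.tail.map unmarked) := rfl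

theorem write_true_unmarked (L : ListBlank (∀ k, Option (Γ k))) :
    (Tape.mk' ∅ (L.map unmarked)).write (setMark true (Tape.mk' ∅ (L.map unmarked)).head) =
      Tape.mk' ∅ (TM2to1.addBottom L) := by
  conv_lhs => rw [← L.cons_head_tail, ListBlank.map_cons]
  rw [addBottom_eq, Tape.write_mk', Tape.mk'_head, ListBlank.head_cons, ListBlank.tail_cons]

theorem write_false_addBottom (L : ListBlank (∀ k, Option (Γ k))) :
    (Tape.mk' ∅ (TM2to1.addBottom L)).write
        (setMark false (Tape.mk' ∅ (TM2to1.addBottom L)).head) =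
      Tape.mk' ∅ (L.map unmarked) := by
  conv_rhs => rw [← L.cons_head_tail, ListBlank.map_cons]
  rw [addBottom_eq, Tape.write_mk', Tape.mk'_head, ListBlank.head_cons, ListBlank.tail_cons]
  rfl

/-- A stack machine with finitely many states is emulated by a Turing machine which starts and
halts on tapes that contain nothing but the stacks. -/
theorem exists_machine_of_stack_machine [DecidableEq K] {Λ σ : Type} [Inhabited Λ] [Inhabited σ]
    [Fintype σ] (M : Λ → TM2.Stmt Γ Λ σ) {S : Finset Λ}
    (hS : TM2.Supports M S) :
    ∃ (Q : Type) (_ : Finite Q) (_ : Inhabited Q) (T : TM0.Machine (TM2to1.Γ' K Γ) Q),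
      ∀ (stk : ∀ k, List (Γ k)) (L : ListBlank (∀ k, Option (Γ k))),
        (∀ k, L.map (proj k) = ListBlank.mk ((stk k).map some).reverse) →
        ∀ x, x ∈ (eval (TM0.step T) ⟨default, Tape.mk' ∅ (L.map unmarked)⟩).map (fun c => c.Tape) ↔
          ∃ c ∈ eval (TM2.step M) ⟨some default, default, stk⟩,
            ∃ L' : ListBlank (∀ k, Option (Γ k)),
              (∀ k, L'.map (proj k) = ListBlank.mk ((c.stk k).map some).reverse) ∧
              x = Tape.mk' ∅ (L'.map unmarked) := by
  classical
  -- Two emulations are composed. The state type of `M₀` need not be finite, so the bracketed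
  -- machine is confined to the finite supporting set `S₀`; its extra steps set and erase the bottom
  -- mark.
  let M₁ := TM2to1.tr M
  have hS₁ := TM2to1.tr_supports M hS
  let M₀ : TM0.Machine (TM2to1.Γ' K Γ) (TM1to0.Λ' M₁) := TM1to0.tr M₁
  have hS₀ := TM1to0.tr_supports M₁ hS₁
  let S₀ := TM1to0.trStmts M₁ (TM2to1.trSupp M S)
  let q₀ : S₀ := ⟨default, hS₀.1⟩
  refine ⟨Option (Option S₀), inferInstance, ⟨none⟩,
    bracketMachine (setMark true) (setMark false) M₀ S₀ q₀, fun stk L hL x => ?_⟩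
  have hstart : eval (TM0.step (bracketMachine (setMark true) (setMark false) M₀ S₀ q₀))
      ⟨none, Tape.mk' ∅ (L.map unmarked)⟩ =
      eval (TM0.step (bracketMachine (setMark true) (setMark false) M₀ S₀ q₀))
        ⟨some (some q₀), Tape.mk' ∅ (TM2to1.addBottom L)⟩ := by
    refine reaches_eval (Relation.ReflTransGen.single ?_)
    exact congrArg (fun T => some (TM0.Cfg.mk (some (some q₀)) T)) (write_true_unmarked L)
  have h₂₁ := TM2to1.TrCfg.mk (q := some (default : Λ)) (v := (default : σ)) L hL
  have h₁₀ : TM1to0.trCfg M₁ ⟨some (TM2to1.Λ'.normal default), default,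
    Tape.mk' ∅ (TM2to1.addBottom L)⟩ = ⟨default, Tape.mk' ∅ (TM2to1.addBottom L)⟩ := rfl
  change x ∈ (eval (TM0.step (bracketMachine (setMark true) (setMark false) M₀ S₀ q₀))
      ⟨none, Tape.mk' ∅ (L.map unmarked)⟩).map (fun c => c.Tape) ↔ _
  rw [hstart, Part.mem_map_iff]
  constructor
  · rintro ⟨b, hb, rfl⟩
    obtain ⟨c₀, hc₀, rfl⟩ := (mem_eval_bracketMachine q₀ hS₀ q₀.2).1 hb
    obtain ⟨c₁, rfl, hc₁⟩ := tr_eval_rev (TM1to0.tr_respects M₁) h₁₀ hc₀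
    obtain ⟨c₂, hc, hc₂⟩ := tr_eval_rev (TM2to1.tr_respects M) h₂₁ hc₁
    refine ⟨c₂, hc₂, ?_⟩
    cases hc with
    | mk L' hL' => exact ⟨L', hL', write_false_addBottom L'⟩
  · rintro ⟨c₂, hc₂, L', hL', rfl⟩
    obtain ⟨c₁, hc, hc₁⟩ := StateTransition.tr_eval (TM2to1.tr_respects M) h₂₁ hc₂
    obtain ⟨c₀, rfl, hc₀⟩ := StateTransition.tr_eval (TM1to0.tr_respects M₁) h₁₀ hc₁
    refine ⟨_, (mem_eval_bracketMachine q₀ hS₀ q₀.2).2 ⟨_, hc₀, rfl⟩, ?_⟩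
    cases hc with
    | mk L'' hL'' =>
      -- The stacks determine the tape, track by track.
      have : L'' = L' := ListBlank.ext fun i => funext fun k => by
        rw [← proj_map_nth, ← proj_map_nth, hL', hL'']
      subst this
      exact write_false_addBottom L''

end TM2

/-! ### Tuples in binary on the tape and on the main stack -/

open PartrecToTM2 (trNat trList K')

/-- The stack symbols that represent `#`, `0` and `1`. -/
def stackSymbol : Option Bool → PartrecToTM2.Γ'
  | none => .cons
  | some false => .bit0
  | some true => .bit1

theorem trNat_eq_bits (n : ℕ) : trNat n = n.bits.map (stackSymbol ∘ some) := by
  have hpos : ∀ p : PosNum, PartrecToTM2.trPosNum p = (p : ℕ).bits.map (stackSymbol ∘ some) := by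
    intro p
    induction p with
    | one => simp [PartrecToTM2.trPosNum, stackSymbol]
    | bit1 p ih =>
      rw [PartrecToTM2.trPosNum, ih, PosNum.cast_bit1, ← two_mul, Nat.bit1_bits]
      rfl
    | bit0 p ih =>
      rw [PartrecToTM2.trPosNum, ih, PosNum.cast_bit0, ← two_mul,
        Nat.bit0_bits _ p.cast_pos.ne']
      rfl
  rw [trNat]
  conv_rhs => rw [← Num.to_of_nat n]
  rcases (n : Num) with _ | p
  · simp [PartrecToTM2.trNum]
  · exact hpos p

theorem trList_append (l l' : List ℕ) : trList (l ++ l') = trList l ++ trList l' := by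
  induction l with
  | nil => rfl
  | cons a l ih => simp [ih]

/-- The tape shows a stack from bottom to top, whereas `trList` lists it from the top, with least
significant bits first. Reversal puts the separator before each number and the most significant bit
first, but it also reverses the tuple. -/
theorem map_tapeWord (l : List ℕ) : (tapeWord l).map stackSymbol = (trList l.reverse).reverse := by
  induction l with
  | nil => rfl
  | cons a l ih =>
    rw [List.reverse_cons, trList_append, List.reverse_append, ← ih]
    simp [tapeWord, trNat_eq_bits, stackSymbol]

/-- The tape symbol with `a` on the main stack. -/
def mainSymbol (a : PartrecToTM2.Γ') : K' → Option PartrecToTM2.Γ' :=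
  fun k => if k = K'.main then some a else none

theorem map_proj_mainSymbol (l : List PartrecToTM2.Γ') (k : K') :
    (ListBlank.mk (l.reverse.map mainSymbol)).map (proj k) =
      ListBlank.mk ((K'.elim l [] [] [] k).map some).reverse := by
  have hnone : ∀ l : List PartrecToTM2.Γ',
      ListBlank.mk (l.map fun _ => (none : Option PartrecToTM2.Γ')) = ListBlank.mk [] := by
    intro l
    refine ListBlank.ext fun i => ?_
    rw [ListBlank.nth_mk, ListBlank.nth_mk, List.getI_eq_getElem?_getD, List.getElem?_map]
    cases l[i]? <;> rfl
  rw [ListBlank.map_mk, List.map_map, ← List.map_reverse]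
  cases k with
  | main => rfl
  | _ => exact hnone l.reverse

theorem eq_of_map_proj {l : List PartrecToTM2.Γ'} {L : ListBlank (K' → Option PartrecToTM2.Γ')}
    (hL : ∀ k, L.map (proj k) = ListBlank.mk ((K'.elim l [] [] [] k).map some).reverse) :
    L = ListBlank.mk (l.reverse.map mainSymbol) :=
  ListBlank.ext fun i => funext fun k => by
    rw [← proj_map_nth, ← proj_map_nth, hL, map_proj_mainSymbol]

/-- Partial recursive functions are computed by Turing machines. -/
theorem isTuringComputable_of_partrec {n : ℕ} {f : List.Vector ℕ n →. ℕ}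
    (hf : Nat.Partrec' f) : IsTuringComputable f := by
  -- The emulated program receives the arguments in reverse order, so it is built for `f` composed
  -- with reversal.
  have hrev : Nat.Partrec' fun v : List.Vector ℕ n => f v.reverse := by
    refine Nat.Partrec'.part_iff.2 ((Nat.Partrec'.part_iff.1 hf).comp
      (Computable.of_eq (Primrec.vector_ofFn fun i => ?_).to_comp fun v =>
      List.Vector.ofFn_get _))
    have : (fun v : List.Vector ℕ n => v.reverse.get i) = fun v => v.get i.rev := by
      funext v
      rw [List.Vector.get_eq_get_toList, List.Vector.get_eq_get_toList, List.get_eq_getElem,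
        List.get_eq_getElem]
      simp only [List.Vector.toList_reverse, List.getElem_reverse, List.Vector.toList_length]
      exact getElem_congr_idx (Nat.sub_sub _ _ _ |>.trans (by rw [Nat.add_comm 1]; rfl))
    rw [this]
    exact Primrec.vector_get.comp Primrec.id (Primrec.const _)
  obtain ⟨c, hc⟩ := ToPartrec.Code.exists_code hrev
  let _ : Inhabited PartrecToTM2.Λ' := ⟨PartrecToTM2.trNormal c .halt⟩
  obtain ⟨Q, hQ, hQi, T, hT⟩ := exists_machine_of_stack_machine PartrecToTM2.tr
    (PartrecToTM2.tr_supports c .halt)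
  have : Fintype K' := ⟨{.main, .rev, .aux, .stack}, fun k => by cases k <;> decide⟩
  refine ⟨TM2to1.Γ' K' fun _ => PartrecToTM2.Γ', Q, inferInstance, hQ, inferInstance, hQi,
    fun a => unmarked.f (mainSymbol (stackSymbol a)), T, ?_, ?_, fun v => ?_⟩
  · intro a b hab
    have h1 : stackSymbol a = stackSymbol b :=
      Option.some_injective _ (congrFun (congrArg Prod.snd hab) K'.main)
    revert h1
    rcases a with _ | _ | _ <;> rcases b with _ | _ | _ <;> simp [stackSymbol]
  · intro a ha
    exact Option.some_ne_none _ (congrFun (congrArg Prod.snd ha) K'.main)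
  · have htape : ∀ l : List ℕ, Tape.mk₁ ((tapeWord l).map
        fun a => unmarked.f (mainSymbol (stackSymbol a))) =
        Tape.mk' ∅ ((ListBlank.mk ((trList l.reverse).reverse.map mainSymbol)).map unmarked) := by
      intro l
      rw [← map_tapeWord, ListBlank.map_mk, List.map_map, List.map_map]
      rfl
    have heval := PartrecToTM2.tr_eval c v.reverse.toList
    rw [show ToPartrec.Code.eval c v.reverse.toList = _ from hc v.reverse] at heval
    refine Part.ext fun x => ?_
    rw [TM0.init, htape]
    have hTx := hT (K'.elim (trList v.reverse.toList) [] [] []) _ (map_proj_mainSymbol _) x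
    rw [List.Vector.toList_reverse] at hTx
    refine hTx.trans ?_
    have hmem : ∀ b, b ∈ eval (TM2.step PartrecToTM2.tr)
        (PartrecToTM2.init c v.reverse.toList) ↔ ∃ y ∈ f v, PartrecToTM2.halt [y] = b := by
      intro b
      rw [heval, List.Vector.reverse_reverse, Part.map_eq_map, Part.map_eq_map, Part.map_map]
      exact Part.mem_map_iff _
    rw [Part.mem_map_iff]
    constructor
    · rintro ⟨b, hb, L', hL', rfl⟩
      obtain ⟨y, hy, rfl⟩ := (hmem b).1 hb
      refine ⟨y, hy, ?_⟩
      rw [htape, eq_of_map_proj hL']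
      rfl
    · rintro ⟨y, hy, rfl⟩
      exact ⟨_, (hmem _).2 ⟨y, hy, rfl⟩, _, map_proj_mainSymbol _, htape [y]⟩

/-! ### Primitive recursive operations -/

section Primrec

variable {α : Type*} [Primcodable α]

theorem primrec_sum_range {g : α → ℕ} {f : α → ℕ → ℕ} (hg : Primrec g) (hf : Primrec₂ f) :
    Primrec fun a => ∑ i ∈ Finset.range (g a), f a i := by
  refine (Primrec.nat_rec' hg (Primrec.const 0) (h := fun a p => p.2 + f a p.1) ?_).of_eq fun a => ?_
  · exact Primrec.nat_add.comp (Primrec.snd.comp Primrec.snd)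
      (hf.comp Primrec.fst (Primrec.fst.comp Primrec.snd))
  · induction g a with
    | zero => rfl
    | succ n ih => rw [Finset.sum_range_succ, ← ih]

theorem primrec_prod_range {g : α → ℕ} {f : α → ℕ → ℕ} (hg : Primrec g) (hf : Primrec₂ f) :
    Primrec fun a => ∏ i ∈ Finset.range (g a), f a i := by
  refine (Primrec.nat_rec' hg (Primrec.const 1) (h := fun a p => p.2 * f a p.1) ?_).of_eq fun a => ?_
  · exact Primrec.nat_mul.comp (Primrec.snd.comp Primrec.snd)
      (hf.comp Primrec.fst (Primrec.fst.comp Primrec.snd))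
  · induction g a with
    | zero => rfl
    | succ n ih => rw [Finset.prod_range_succ, ← ih]

theorem primrec_pow {f g : α → ℕ} (hf : Primrec f) (hg : Primrec g) :
    Primrec fun a => f a ^ g a :=
  (primrec_prod_range hg (f := fun a _ => f a) (hf.comp Primrec.fst)).of_eq fun a => by simp

theorem primrecPred_forall_lt {g : α → ℕ} {p : α → ℕ → Prop} (hg : Primrec g)
    (hp : PrimrecPred fun q : α × ℕ => p q.1 q.2) : PrimrecPred fun a => ∀ i < g a, p a i :=
  ((PrimrecRel.forall_mem_list (R := fun i a => p a i) (PrimrecPred.comp hp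
    (Primrec.snd.pair Primrec.fst))).comp (Primrec.list_range.comp hg) Primrec.id).of_eq
    fun a => by simp

end Primrec

/-! ### The search for a block code

In this section `lh` and `proj` are the length and the projections of an encoding of finite
sequences. -/

section Search

variable (code : List ℕ → ℕ) (lh : ℕ → ℕ) (proj : ℕ → ℕ → ℕ)

/-- An upper bound of `2 ^ k * α`, where `e` is a code of the number `α ∈ [0, 1]`, which is close
to `2 ^ k * α` if `f` steps are enough to evaluate the `k`-th approximation of `α`. -/
def scaledBound (f k e : ℕ) : ℕ :=
  (Nat.Partrec.Code.evaln f (Denumerable.ofNat Nat.Partrec.Code e) k).elim (2 ^ k) fun v =>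
    -- One unit covers the approximation error and one the rounding down. An odd sign exponent means
    -- an approximation `≤ 0`, hence `2 ^ k * α < 1`.
    if proj v 0 % 2 = 0 then proj v 1 * 2 ^ k / proj v 2 + 2 else 2

/-- The number `x` encodes a sequence of length `n` of numbers between `1` and `B`. -/
def IsWord (B n x : ℕ) : Prop :=
  (∃ l, code l = x) ∧ lh x = n ∧ ∀ i < n, 0 < proj x i ∧ proj x i ≤ B

/-- The number `u` encodes a block code. -/
def IsBlockCodeNumber (M N n u : ℕ) : Prop :=
  (∃ l, code l = u) ∧ lh u = 2 ∧ (∃ l, code l = proj u 0) ∧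
    (∀ w < lh (proj u 0), IsWord code lh proj M n (proj (proj u 0) w)) ∧
    IsWord code lh proj (lh (proj u 0)) (N ^ n) (proj u 1)

/-- An upper bound of `2 ^ (k * n)` times the error probability of the message `w` for the channel
with code `c` and the block code with code `u`. -/
def errorBound (c f k n u w : ℕ) : ℕ :=
  ∑ j ∈ Finset.range (lh (proj c 0) ^ n), if proj (proj u 1) j = w + 1 then 0 else
    ∏ i ∈ Finset.range n, scaledBound proj f k
      (proj (proj c (proj (proj (proj u 0) w) i - 1))
        (j / lh (proj c 0) ^ (n - 1 - i) % lh (proj c 0)))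

/-- The number `u` encodes a block code of length `n` that is verified to be good by computing
approximations of the transition probabilities. -/
def IsGood (c r e f k n u : ℕ) : Prop :=
  0 < n ∧ IsBlockCodeNumber code lh proj (lh c) (lh (proj c 0)) n u ∧
    -- With `R = a / d`, this and the next line state in integers that the number of messages is
    -- `⌈2^(nR)⌉`.
    2 ^ (n * proj r 1) ≤ lh (proj u 0) ^ proj r 2 ∧
    (lh (proj u 0) - 1) ^ proj r 2 < 2 ^ (n * proj r 1) ∧
    ∀ w < lh (proj u 0), errorBound lh proj c f k n u w * proj e 2 < proj e 1 * 2 ^ (k * n)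

section Primrec

variable {code lh proj} {α : Type*} [Primcodable α]

/-- The step bound `f` is what makes this primitive recursive: bounded evaluation `evaln` is, the
universal function is not. -/
theorem primrec_scaledBound (hproj : Primrec₂ proj) {f k e : α → ℕ} (hf : Primrec f)
    (hk : Primrec k) (he : Primrec e) :
    Primrec fun a => scaledBound proj (f a) (k a) (e a) := by
  have hev : Primrec fun a => Nat.Partrec.Code.evaln (f a)
      (Denumerable.ofNat Nat.Partrec.Code (e a)) (k a) :=
    Nat.Partrec.Code.primrec_evaln.comp
      ((hf.pair ((Primrec.ofNat Nat.Partrec.Code).comp he)).pair hk)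
  have hv : ∀ i, Primrec fun p : α × ℕ => proj p.2 i := fun i =>
    hproj.comp Primrec.snd (Primrec.const i)
  refine (Primrec.option_casesOn hev (primrec_pow (Primrec.const 2) hk)
    (g := fun a v => if proj v 0 % 2 = 0 then proj v 1 * 2 ^ k a / proj v 2 + 2 else 2)
    (Primrec.ite (Primrec.eq.comp (Primrec.nat_mod.comp (hv 0) (Primrec.const 2))
      (Primrec.const 0)) (Primrec.nat_add.comp (Primrec.nat_div.comp (Primrec.nat_mul.comp (hv 1)
        (primrec_pow (Primrec.const 2) (hk.comp Primrec.fst))) (hv 2)) (Primrec.const 2))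
      (Primrec.const 2))).of_eq fun a => ?_
  unfold scaledBound
  cases Nat.Partrec.Code.evaln (f a) (Denumerable.ofNat Nat.Partrec.Code (e a)) (k a) <;> rfl

theorem primrecPred_isWord (hproj : Primrec₂ proj)
    (hseq : PrimrecPred fun u : ℕ => ∃ l : List ℕ, code l = u) (hlh : Primrec lh)
    {B n x : α → ℕ} (hB : Primrec B) (hn : Primrec n) (hx : Primrec x) :
    PrimrecPred fun a => IsWord code lh proj (B a) (n a) (x a) := by
  have hxi : Primrec fun p : α × ℕ => proj (x p.1) p.2 :=
    hproj.comp (hx.comp Primrec.fst) Primrec.snd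
  exact (hseq.comp hx).and ((Primrec.eq.comp (hlh.comp hx) hn).and (primrecPred_forall_lt hn
    ((Primrec.nat_lt.comp (Primrec.const 0) hxi).and
      (Primrec.nat_le.comp hxi (hB.comp Primrec.fst)))))

theorem primrecPred_isBlockCodeNumber (hproj : Primrec₂ proj)
    (hseq : PrimrecPred fun u : ℕ => ∃ l : List ℕ, code l = u) (hlh : Primrec lh)
    {M N n u : α → ℕ} (hM : Primrec M) (hN : Primrec N)
    (hn : Primrec n) (hu : Primrec u) :
    PrimrecPred fun a => IsBlockCodeNumber code lh proj (M a) (N a) (n a) (u a) := by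
  have hui : ∀ i, Primrec fun a => proj (u a) i := fun i => hproj.comp hu (Primrec.const i)
  exact (hseq.comp hu).and ((Primrec.eq.comp (hlh.comp hu) (Primrec.const 2)).and
    ((hseq.comp (hui 0)).and ((primrecPred_forall_lt (hlh.comp (hui 0))
      (primrecPred_isWord hproj hseq hlh (hM.comp Primrec.fst) (hn.comp Primrec.fst)
        (hproj.comp ((hui 0).comp Primrec.fst) Primrec.snd))).and
      (primrecPred_isWord hproj hseq hlh (hlh.comp (hui 0)) (primrec_pow hN hn) (hui 1)))))

theorem primrec_errorBound (hproj : Primrec₂ proj) (hlh : Primrec lh)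
    {c f k n u w : α → ℕ} (hc : Primrec c) (hf : Primrec f)
    (hk : Primrec k) (hn : Primrec n) (hu : Primrec u) (hw : Primrec w) :
    Primrec fun a => errorBound lh proj (c a) (f a) (k a) (n a) (u a) (w a) := by
  have hui : ∀ i, Primrec fun a => proj (u a) i := fun i => hproj.comp hu (Primrec.const i)
  have hN : Primrec fun a => lh (proj (c a) 0) := hlh.comp (hproj.comp hc (Primrec.const 0))
  have h1 : Primrec fun p : (α × ℕ) × ℕ => p.1.1 := Primrec.fst.comp Primrec.fst
  have h2 : Primrec fun p : (α × ℕ) × ℕ => p.1.2 := Primrec.snd.comp Primrec.fst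
  have hN' := hN.comp h1
  refine primrec_sum_range (primrec_pow hN hn) (Primrec.ite (Primrec.eq.comp
    (hproj.comp ((hui 1).comp Primrec.fst) Primrec.snd)
    (Primrec.succ.comp (hw.comp Primrec.fst))) (Primrec.const 0)
    (primrec_prod_range (hn.comp Primrec.fst) (primrec_scaledBound hproj (hf.comp h1) (hk.comp h1)
      (hproj.comp (hproj.comp (hc.comp h1) (Primrec.nat_sub.comp (hproj.comp
        (hproj.comp ((hui 0).comp h1) (hw.comp h1)) Primrec.snd) (Primrec.const 1)))
        (Primrec.nat_mod.comp (Primrec.nat_div.comp h2 (primrec_pow hN' (Primrec.nat_sub.comp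
          (Primrec.nat_sub.comp (hn.comp h1) (Primrec.const 1)) Primrec.snd))) hN')))))

theorem primrecPred_isGood (hproj : Primrec₂ proj)
    (hseq : PrimrecPred fun u : ℕ => ∃ l : List ℕ, code l = u) (hlh : Primrec lh)
    {c r e f k n u : α → ℕ} (hc : Primrec c) (hr : Primrec r)
    (he : Primrec e) (hf : Primrec f) (hk : Primrec k) (hn : Primrec n) (hu : Primrec u) :
    PrimrecPred fun a => IsGood code lh proj (c a) (r a) (e a) (f a) (k a) (n a) (u a) := by
  have hm : Primrec fun a => lh (proj (u a) 0) := hlh.comp (hproj.comp hu (Primrec.const 0))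
  have hN : Primrec fun a => lh (proj (c a) 0) := hlh.comp (hproj.comp hc (Primrec.const 0))
  have hri : ∀ i, Primrec fun a => proj (r a) i := fun i => hproj.comp hr (Primrec.const i)
  have hei : ∀ i, Primrec fun a => proj (e a) i := fun i => hproj.comp he (Primrec.const i)
  have h2 := primrec_pow (Primrec.const 2) (Primrec.nat_mul.comp hn (hri 1))
  exact (Primrec.nat_lt.comp (Primrec.const 0) hn).and
    ((primrecPred_isBlockCodeNumber hproj hseq hlh (hlh.comp hc) hN hn hu).and
    ((Primrec.nat_le.comp h2 (primrec_pow hm (hri 2))).and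
    ((Primrec.nat_lt.comp (primrec_pow (Primrec.nat_sub.comp hm (Primrec.const 1)) (hri 2)) h2).and
    (primrecPred_forall_lt hm (Primrec.nat_lt.comp (Primrec.nat_mul.comp
      (primrec_errorBound hproj hlh (hc.comp Primrec.fst) (hf.comp Primrec.fst)
        (hk.comp Primrec.fst) (hn.comp Primrec.fst) (hu.comp Primrec.fst) Primrec.snd)
      ((hei 2).comp Primrec.fst)) (Primrec.nat_mul.comp ((hei 1).comp Primrec.fst)
        (primrec_pow (Primrec.const 2) ((Primrec.nat_mul.comp hk hn).comp Primrec.fst))))))))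

end Primrec

open Classical in
/-- Search for a block code that is verified to be good. -/
def findCode : List.Vector ℕ 3 →. ℕ := fun v =>
  -- A single number `t` ranges over all tuples `(f, k, n, u)` by iterated pairing.
  (Nat.rfind fun t => Part.some (decide (IsGood code lh proj (v.get 0) (v.get 1) (v.get 2)
    t.unpair.1 t.unpair.2.unpair.1 t.unpair.2.unpair.2.unpair.1 t.unpair.2.unpair.2.unpair.2))).map
    fun t => t.unpair.2.unpair.2.unpair.2

variable {code lh proj}

theorem partrec_findCode (hproj : Primrec₂ proj)
    (hseq : PrimrecPred fun u : ℕ => ∃ l : List ℕ, code l = u) (hlh : Primrec lh) :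
    Nat.Partrec' (findCode code lh proj) := by
  classical
  refine Nat.Partrec'.part_iff.2 ?_
  have hl : Primrec fun t : ℕ => t.unpair.1 := Primrec.fst.comp Primrec.unpair
  have hr : Primrec fun t : ℕ => t.unpair.2 := Primrec.snd.comp Primrec.unpair
  have hs : Primrec fun p : List.Vector ℕ 3 × ℕ => p.2 := Primrec.snd
  have hv : ∀ i, Primrec fun p : List.Vector ℕ 3 × ℕ => p.1.get i := fun i =>
    Primrec.vector_get.comp Primrec.fst (Primrec.const i)
  have hgood : PrimrecPred fun p : List.Vector ℕ 3 × ℕ => IsGood code lh proj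
      (p.1.get 0) (p.1.get 1) (p.1.get 2) p.2.unpair.1 p.2.unpair.2.unpair.1
      p.2.unpair.2.unpair.2.unpair.1 p.2.unpair.2.unpair.2.unpair.2 :=
    primrecPred_isGood hproj hseq hlh (hv 0) (hv 1) (hv 2) (hl.comp hs)
      (hl.comp (hr.comp hs)) (hl.comp (hr.comp (hr.comp hs))) (hr.comp (hr.comp (hr.comp hs)))
  refine Partrec.map (Partrec.rfind ?_) ((hr.comp (hr.comp (hr.comp hs))).to_comp.to₂)
  exact (hgood.decide.to_comp.partrec).of_eq fun p => rfl

theorem exists_isGood_of_mem_findCode {v : List.Vector ℕ 3} {u : ℕ}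
    (h : u ∈ findCode code lh proj v) :
    ∃ f k n, IsGood code lh proj (v.get 0) (v.get 1) (v.get 2) f k n u := by
  obtain ⟨t, ht, rfl⟩ := (Part.mem_map_iff _).1 h
  exact ⟨_, _, _, by simpa using Nat.rfind_spec ht⟩

theorem findCode_dom {v : List.Vector ℕ 3} {f k n u : ℕ}
    (h : IsGood code lh proj (v.get 0) (v.get 1) (v.get 2) f k n u) :
    (findCode code lh proj v).Dom := by
  refine Nat.rfind_dom.2 ⟨Nat.pair f (Nat.pair k (Nat.pair n u)), ?_, fun _ => trivial⟩
  simpa using h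

end Search

/-! ### Correctness of the search -/

/-- Positivity rules out a negative sign, so the search may ignore the sign entry of `R` and `ε`. -/
theorem eq_div_of_isRatCode {code : List ℕ → ℕ} {proj : ℕ → ℕ → ℕ}
    (hproj : ∀ (l : List ℕ) (i : ℕ) (hi : i < l.length), proj (code l) i = l[i]) {q : ℚ} {u : ℕ}
    (h : IsRatCode code q u) (hq : 0 < q) :
    0 < proj u 2 ∧ (q : ℝ) = proj u 1 / proj u 2 := by
  obtain ⟨s, a, d, hd, rfl, rfl⟩ := h
  have h1 : proj (code [s, a, d]) 1 = a := hproj _ 1 (by simp)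
  have h2 : proj (code [s, a, d]) 2 = d := hproj _ 2 (by simp)
  rw [h1, h2]
  refine ⟨Nat.pos_of_ne_zero hd, ?_⟩
  rcases neg_one_pow_eq_or ℚ s with h | h
  · simp [h]
  · rw [h] at hq
    have : (0 : ℚ) ≤ a / d := by positivity
    linarith

/-- Raising to the `d`-th power turns comparisons with `2 ^ (n * a / d)` into comparisons of
integers. -/
theorem ceil_two_rpow_eq_iff {n a d m : ℕ} (hd : 0 < d) :
    ⌈(2 : ℝ) ^ ((n : ℝ) * (a / d : ℝ))⌉₊ = m ↔
      2 ^ (n * a) ≤ m ^ d ∧ (m - 1) ^ d < 2 ^ (n * a) := by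
  set x : ℝ := (2 : ℝ) ^ ((n : ℝ) * (a / d : ℝ)) with hx
  have hx0 : 0 < x := Real.rpow_pos_of_pos two_pos _
  have hxd : x ^ d = ((2 ^ (n * a) : ℕ) : ℝ) := by
    rw [hx, ← Real.rpow_natCast, ← Real.rpow_mul two_pos.le, Nat.cast_pow, Nat.cast_ofNat,
      ← Real.rpow_natCast]
    congr 1
    push_cast
    field_simp
  have hle : 2 ^ (n * a) ≤ m ^ d ↔ x ≤ m := by
    rw [← Nat.cast_le (α := ℝ), ← hxd, Nat.cast_pow,
      pow_le_pow_iff_left₀ hx0.le (Nat.cast_nonneg m) hd.ne']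
  have hlt : (m - 1) ^ d < 2 ^ (n * a) ↔ ((m - 1 : ℕ) : ℝ) < x := by
    rw [← Nat.cast_lt (α := ℝ), ← hxd, Nat.cast_pow,
      pow_lt_pow_iff_left₀ (Nat.cast_nonneg _) hx0.le hd.ne']
  rw [hle, hlt]
  -- Here `m - 1` is truncated, but both sides are false since the power is positive.
  by_cases hm : m = 0
  · subst hm
    simp only [Nat.ceil_eq_zero]
    constructor
    · intro h; exact absurd h (not_le.2 hx0)
    · intro h; simpa using h.1
  · rw [Nat.ceil_eq_iff hm, and_comm]

/-- The enumeration of the words in lexicographic order. -/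
def lexEquiv (N n : ℕ) : Fin (N ^ n) ≃ (Fin n → Fin N) :=
  finFunctionFinEquiv.symm.trans (Fin.revPerm.arrowCongr (Equiv.refl _))

theorem lexEquiv_apply {N n : ℕ} (k : Fin (N ^ n)) : lexEquiv N n k = lexWord k := rfl

theorem lexWord_val {N n : ℕ} (k : Fin (N ^ n)) (i : Fin n) :
    (lexWord k i : ℕ) = k / N ^ (n - 1 - i) % N := by
  have : (i.rev : ℕ) = n - 1 - i := by rw [Fin.val_rev, Nat.sub_sub, Nat.add_comm]
  rw [← this]
  rfl

/-! ### Block codes and their numbers -/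

section

variable {code : List ℕ → ℕ} {lh : ℕ → ℕ} {proj : ℕ → ℕ → ℕ}

theorem proj_code_ofFn
    (hproj : ∀ (l : List ℕ) (i : ℕ) (hi : i < l.length), proj (code l) i = l[i])
    {n : ℕ} (f : Fin n → ℕ) (i : Fin n) : proj (code (List.ofFn f)) i = f i := by
  rw [hproj _ _ (by simp)]
  simp

theorem code_ofFn_eq (hlh : ∀ l : List ℕ, lh (code l) = l.length)
    (hproj : ∀ (l : List ℕ) (i : ℕ) (hi : i < l.length), proj (code l) i = l[i])
    {x n : ℕ} (hx : ∃ l, code l = x) (hn : lh x = n) :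
    code (List.ofFn fun i : Fin n => proj x i) = x := by
  obtain ⟨l, rfl⟩ := hx
  rw [hlh] at hn
  subst hn
  refine congrArg code (List.ext_getElem (by simp) fun i _ hi => ?_)
  simpa using hproj l i hi

theorem isWord_code_ofFn (hlh : ∀ l : List ℕ, lh (code l) = l.length)
    (hproj : ∀ (l : List ℕ) (i : ℕ) (hi : i < l.length), proj (code l) i = l[i])
    {B n : ℕ} (f : Fin n → Fin B) :
    IsWord code lh proj B n (code (List.ofFn fun i => (f i : ℕ) + 1)) := by
  refine ⟨⟨_, rfl⟩, by simp [hlh], fun i hi => ?_⟩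
  rw [proj_code_ofFn hproj _ ⟨i, hi⟩]
  exact ⟨Nat.succ_pos _, (f ⟨i, hi⟩).2⟩

theorem exists_eq_code_of_isWord (hlh : ∀ l : List ℕ, lh (code l) = l.length)
    (hproj : ∀ (l : List ℕ) (i : ℕ) (hi : i < l.length), proj (code l) i = l[i])
    {B n x : ℕ} (h : IsWord code lh proj B n x) :
    ∃ f : Fin n → Fin B, code (List.ofFn fun i => (f i : ℕ) + 1) = x := by
  refine ⟨fun i => ⟨proj x i - 1, by have := h.2.2 i i.2; omega⟩, ?_⟩
  refine Eq.trans ?_ (code_ofFn_eq hlh hproj h.1 h.2.1)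
  exact congrArg (fun f => code (List.ofFn f))
    (funext fun i => Nat.sub_add_cancel (h.2.2 i i.2).1)

namespace BlockCode

variable {M N m n : ℕ} (C : BlockCode M N m n)

theorem proj_number_zero
    (hproj : ∀ (l : List ℕ) (i : ℕ) (hi : i < l.length), proj (code l) i = l[i]) :
    proj (C.number code) 0 = C.encNumber code := hproj _ 0 (by simp)

theorem proj_number_one
    (hproj : ∀ (l : List ℕ) (i : ℕ) (hi : i < l.length), proj (code l) i = l[i]) :
    proj (C.number code) 1 = C.decNumber code := hproj _ 1 (by simp)

theorem lh_proj_number_zero (hlh : ∀ l : List ℕ, lh (code l) = l.length)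
    (hproj : ∀ (l : List ℕ) (i : ℕ) (hi : i < l.length), proj (code l) i = l[i]) :
    lh (proj (C.number code) 0) = m := by
  rw [C.proj_number_zero hproj, encNumber, hlh, List.length_ofFn]

theorem isBlockCodeNumber (hlh : ∀ l : List ℕ, lh (code l) = l.length)
    (hproj : ∀ (l : List ℕ) (i : ℕ) (hi : i < l.length), proj (code l) i = l[i]) :
    IsBlockCodeNumber code lh proj M N n (C.number code) := by
  refine ⟨⟨_, rfl⟩, hlh _, ?_, ?_, ?_⟩
  · exact ⟨_, (C.proj_number_zero hproj).symm⟩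
  · rw [C.lh_proj_number_zero hlh hproj, C.proj_number_zero hproj]
    intro w hw
    rw [encNumber, proj_code_ofFn hproj _ ⟨w, hw⟩]
    exact isWord_code_ofFn hlh hproj _
  · rw [C.lh_proj_number_zero hlh hproj, C.proj_number_one hproj]
    exact isWord_code_ofFn hlh hproj _

theorem exists_number_eq (hlh : ∀ l : List ℕ, lh (code l) = l.length)
    (hproj : ∀ (l : List ℕ) (i : ℕ) (hi : i < l.length), proj (code l) i = l[i])
    {M N n u : ℕ} (h : IsBlockCodeNumber code lh proj M N n u) :
    ∃ C : BlockCode M N (lh (proj u 0)) n, C.number code = u := by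
  obtain ⟨hu, hu2, hE, hEw, hD⟩ := h
  choose E hE' using fun w : Fin (lh (proj u 0)) =>
    exists_eq_code_of_isWord hlh hproj (hEw w w.2)
  obtain ⟨D, hD'⟩ := exists_eq_code_of_isWord hlh hproj hD
  refine ⟨⟨E, fun y => D ((lexEquiv N n).symm y)⟩, ?_⟩
  have h0 : BlockCode.encNumber (N := N) ⟨E, fun y => D ((lexEquiv N n).symm y)⟩ code =
      proj u 0 := by
    refine Eq.trans ?_ (code_ofFn_eq hlh hproj hE rfl)
    simp only [encNumber, hE']
  have h1 : BlockCode.decNumber (M := M) ⟨E, fun y => D ((lexEquiv N n).symm y)⟩ code =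
      proj u 1 := by
    rw [decNumber, ← hD']
    simp only [← lexEquiv_apply, Equiv.symm_apply_apply]
  rw [number, h0, h1]
  refine Eq.trans ?_ (code_ofFn_eq hlh hproj hu hu2)
  simp [List.ofFn_succ]

/-- Links the arithmetic on codes with a sum over words. Positivity of `M` matters because `N` is
read off as the length of the first row. -/
theorem errorBound_eq (hlh : ∀ l : List ℕ, lh (code l) = l.length)
    (hproj : ∀ (l : List ℕ) (i : ℕ) (hi : i < l.length), proj (code l) i = l[i])
    (hM : 0 < M) (c : Fin M → Fin N → ℕ) (f k : ℕ) (w : Fin m) :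
    errorBound lh proj (code (List.ofFn fun x => code (List.ofFn fun y => c x y))) f k n
      (C.number code) w =
      ∑ y with C.dec y ≠ w, ∏ i, scaledBound proj f k (c (C.enc w i) (y i)) := by
  have hN : lh (proj (code (List.ofFn fun x => code (List.ofFn fun y => c x y))) 0) = N := by
    rw [proj_code_ofFn hproj _ ⟨0, hM⟩, hlh, List.length_ofFn]
  rw [errorBound, hN, Finset.sum_range, Finset.sum_filter, ← (lexEquiv N n).sum_comp]
  refine Finset.sum_congr rfl fun j _ => ?_
  rw [C.proj_number_one hproj, C.proj_number_zero hproj, decNumber, proj_code_ofFn hproj,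
    encNumber, proj_code_ofFn hproj _ w, lexEquiv_apply, Finset.prod_range]
  simp only [Nat.add_right_cancel_iff, Fin.val_inj, ne_eq, ite_not]
  congr 1
  refine Finset.prod_congr rfl fun i _ => ?_
  rw [← lexWord_val, proj_code_ofFn hproj _ i, Nat.add_sub_cancel, proj_code_ofFn hproj _ (C.enc w i),
    proj_code_ofFn hproj]

end BlockCode

/-- The upper bound holds even when the evaluation times out, because then `2 ^ k` is used and `α ≤
1`; closeness needs `f` large enough for the evaluation to finish. -/
theorem scaledBound_bounds
    (hproj : ∀ (l : List ℕ) (i : ℕ) (hi : i < l.length), proj (code l) i = l[i])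
    {α : ℝ} {e : ℕ} (h : IsRealCode code α e) (h0 : 0 ≤ α) (h1 : α ≤ 1) (k : ℕ) :
    (∀ f, α * 2 ^ k ≤ scaledBound proj f k e) ∧
      ∀ᶠ f in Filter.atTop, (scaledBound proj f k e : ℝ) ≤ α * 2 ^ k + 3 := by
  obtain ⟨s, a, d, -, -, -, hd, happ, hev⟩ := h
  have hk : (0 : ℝ) < 2 ^ k := by positivity
  have hval : ∀ f, ∀ v ∈ Nat.Partrec.Code.evaln f (Denumerable.ofNat Nat.Partrec.Code e) k,
      α * 2 ^ k ≤ scaledBound proj f k e ∧ (scaledBound proj f k e : ℝ) ≤ α * 2 ^ k + 3 := by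
    intro f v hv
    have hv' : v = code [s k, a k, d k] := by
      have := Nat.Partrec.Code.evaln_sound hv
      rw [show (Denumerable.ofNat Nat.Partrec.Code e).eval k = _ from hev k] at this
      exact Part.mem_some_iff.1 this
    subst hv'
    have hp0 : proj (code [s k, a k, d k]) 0 = s k := hproj _ 0 (by simp)
    have hp1 : proj (code [s k, a k, d k]) 1 = a k := hproj _ 1 (by simp)
    have hp2 : proj (code [s k, a k, d k]) 2 = d k := hproj _ 2 (by simp)
    rw [scaledBound, Option.mem_def.1 hv, Option.elim_some, hp0, hp1, hp2]
    have hα1 := (abs_lt.1 (happ k)).1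
    have hα2 := (abs_lt.1 (happ k)).2
    rw [lt_div_iff₀ hk] at hα2
    rw [← neg_div, div_lt_iff₀ hk] at hα1
    split_ifs with hs
    · have hs' : (-1 : ℝ) ^ s k = 1 := (Nat.even_iff.2 hs).neg_one_pow
      rw [hs', one_mul] at hα1 hα2
      have hle : ((a k * 2 ^ k / d k : ℕ) : ℝ) ≤ a k / d k * 2 ^ k := by
        refine Nat.cast_div_le.trans_eq ?_
        push_cast
        ring
      have hlt : (a k / d k * 2 ^ k : ℝ) < ((a k * 2 ^ k / d k : ℕ) : ℝ) + 1 := by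
        have := Nat.lt_floor_add_one (((a k * 2 ^ k : ℕ) : ℝ) / (d k : ℕ))
        rw [Nat.floor_div_eq_div] at this
        refine lt_of_eq_of_lt ?_ this
        push_cast
        ring
      push_cast
      constructor <;> nlinarith
    · have hs' : (-1 : ℝ) ^ s k = -1 := (Nat.not_even_iff_odd.1 (mt Nat.even_iff.1 hs)).neg_one_pow
      have : (0 : ℝ) ≤ a k / d k * 2 ^ k := by positivity
      have h3 : 0 ≤ α * 2 ^ k := by positivity
      rw [hs'] at hα2
      push_cast
      constructor <;> linarith
  constructor
  · intro f
    rcases hf : Nat.Partrec.Code.evaln f (Denumerable.ofNat Nat.Partrec.Code e) k with _ | v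
    · simpa [scaledBound, hf] using h1
    · exact (hval f v hf).1
  · have hmem : code [s k, a k, d k] ∈ (Denumerable.ofNat Nat.Partrec.Code e).eval k := by
      rw [show (Denumerable.ofNat Nat.Partrec.Code e).eval k = _ from hev k]
      exact Part.mem_some _
    obtain ⟨f₀, hf₀⟩ := Nat.Partrec.Code.evaln_complete.1 hmem
    filter_upwards [Filter.eventually_ge_atTop f₀] with f hf
    exact (hval f _ (Nat.Partrec.Code.evaln_mono hf hf₀)).2

theorem DMC.prob_le_one {M N : ℕ} (H : DMC M N) (x : Fin M) (y : Fin N) : H.prob x y ≤ 1 :=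
  H.sum_eq_one x ▸ Finset.single_le_sum (fun y _ => H.nonneg x y) (Finset.mem_univ y)

/-! ### Soundness and completeness of the error bounds -/

namespace BlockCode

variable {M N m n : ℕ} (C : BlockCode M N m n) {H : DMC M N} {c : Fin M → Fin N → ℕ}

theorem blockError_le
    (hproj : ∀ (l : List ℕ) (i : ℕ) (hi : i < l.length), proj (code l) i = l[i])
    (hc : ∀ x y, IsRealCode code (H.prob x y) (c x y)) (f k : ℕ) (w : Fin m) :
    C.blockError H w * 2 ^ (k * n) ≤
      (∑ y with C.dec y ≠ w, ∏ i, scaledBound proj f k (c (C.enc w i) (y i)) : ℕ) := by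
  rw [blockError, Finset.sum_mul]
  push_cast
  refine Finset.sum_le_sum fun y _ => ?_
  have : (2 : ℝ) ^ (k * n) = ∏ _i : Fin n, 2 ^ k := by simp [pow_mul]
  rw [DMC.wordProb, this, ← Finset.prod_mul_distrib]
  exact Finset.prod_le_prod (fun i _ => mul_nonneg (H.nonneg _ _) (by positivity)) fun i _ =>
    (scaledBound_bounds hproj (hc _ _) (H.nonneg _ _) (H.prob_le_one _ _) k).1 f

/-- After division by `2 ^ k` the bounds exceed the probabilities by at most `3 / 2 ^ k`, so the
resulting error bounds tend to the true errors, which are strictly below `ε`. -/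
theorem exists_errorBound_lt
    (hproj : ∀ (l : List ℕ) (i : ℕ) (hi : i < l.length), proj (code l) i = l[i])
    (hc : ∀ x y, IsRealCode code (H.prob x y) (c x y)) {ε : ℝ} (hε : C.maxBlockError H < ε) :
    ∃ f k, ∀ w, ((∑ y with C.dec y ≠ w, ∏ i, scaledBound proj f k (c (C.enc w i) (y i)) : ℕ) : ℝ) <
      ε * 2 ^ (k * n) := by
  have hδ : Filter.Tendsto (fun k : ℕ => 3 * (1 / 2 : ℝ) ^ k) Filter.atTop (nhds 0) := by
    simpa using (tendsto_pow_atTop_nhds_zero_of_lt_one (by norm_num : (0 : ℝ) ≤ 1 / 2)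
      (by norm_num)).const_mul 3
  have hlim : ∀ w, Filter.Tendsto (fun k : ℕ => ∑ y with C.dec y ≠ w,
      ∏ i, (H.prob (C.enc w i) (y i) + 3 * (1 / 2 : ℝ) ^ k)) Filter.atTop
      (nhds (C.blockError H w)) := by
    intro w
    refine tendsto_finsetSum _ fun y _ => tendsto_finsetProd _ fun i _ => ?_
    simpa using hδ.const_add (H.prob (C.enc w i) (y i))
  have hlt : ∀ w, C.blockError H w < ε := fun w =>
    (le_ciSup (Set.finite_range _).bddAbove w).trans_lt hε
  -- First a precision `k` that serves all messages, then a step bound `f` that serves all channel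
  -- entries at this precision.
  obtain ⟨k, hk⟩ := (Filter.eventually_all.2 fun w =>
    (hlim w).eventually_lt_const (hlt w)).exists
  obtain ⟨f, hf⟩ := (Filter.eventually_all.2 fun x => Filter.eventually_all.2 fun y =>
    (scaledBound_bounds hproj (hc x y) (H.nonneg _ _) (H.prob_le_one _ _) k).2).exists
  refine ⟨f, k, fun w => lt_of_le_of_lt ?_ (mul_lt_mul_of_pos_right (hk w) (by positivity))⟩
  rw [Finset.sum_mul]
  push_cast
  refine Finset.sum_le_sum fun y _ => ?_
  have : (2 : ℝ) ^ (k * n) = ∏ _i : Fin n, 2 ^ k := by simp [pow_mul]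
  rw [this, ← Finset.prod_mul_distrib]
  refine Finset.prod_le_prod (fun i _ => Nat.cast_nonneg _) fun i _ => (hf _ _).trans_eq ?_
  rw [add_mul, mul_assoc 3, ← mul_pow]
  norm_num

end BlockCode

end

end

end ChannelCoding

/-! ### The main theorem -/

theorem mainTheorem1 (code : List ℕ → ℕ) (hcode : ChannelCoding.IsPrimrecEncoding code) :
    ∃ FindCode : List.Vector ℕ 3 →. ℕ,
      Nat.Partrec' FindCode ∧
      ChannelCoding.IsTuringComputable FindCode ∧
      ∀ (M N : ℕ), 0 < M → 0 < N → ∀ (H : ChannelCoding.DMC M N) (R ε : ℚ),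
        0 < R → (R : ℝ) < H.capacity → 0 < ε →
        ∀ cH cR cε : ℕ, H.IsCode code cH →
          ChannelCoding.IsRatCode code R cR → ChannelCoding.IsRatCode code ε cε →
          ∃ (n m : ℕ) (C : ChannelCoding.BlockCode M N m n),
            0 < n ∧
            m = ⌈(2 : ℝ) ^ ((n : ℝ) * (R : ℝ))⌉₊ ∧
            C.number code ∈ FindCode (cH ::ᵥ cR ::ᵥ cε ::ᵥ List.Vector.nil) ∧
            (R : ℝ) ≤ C.rate ∧
            C.maxBlockError H < (ε : ℝ) := by
  obtain ⟨-, hseq, -, -, ⟨lh, hlhp, hlh⟩, -, ⟨proj, hprojp, hproj⟩⟩ := hcode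
  have hpart := ChannelCoding.partrec_findCode hprojp hseq hlhp
  refine ⟨ChannelCoding.findCode code lh proj, hpart,
    ChannelCoding.isTuringComputable_of_partrec hpart, ?_⟩
  rintro M N hM - H R ε hR hRC hε _ cR cε ⟨c, hc, rfl⟩ hcR hcε
  obtain ⟨hR2, hReq⟩ := ChannelCoding.eq_div_of_isRatCode hproj hcR hR
  obtain ⟨hε2, hεeq⟩ := ChannelCoding.eq_div_of_isRatCode hproj hcε hε
  set cH := code (List.ofFn fun x => code (List.ofFn fun y => c x y)) with hcH
  have hlM : lh cH = M := by rw [hcH, hlh, List.length_ofFn]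
  have hlN : lh (proj cH 0) = N := by
    rw [hcH, ChannelCoding.proj_code_ofFn hproj _ ⟨0, hM⟩, hlh, List.length_ofFn]
  have hε2' : (0 : ℝ) < proj cε 2 := Nat.cast_pos.2 hε2
  have hcmp : ∀ b p : ℕ, b * proj cε 2 < proj cε 1 * 2 ^ p ↔ (b : ℝ) < ε * 2 ^ p := by
    intro b p
    rw [hεeq, div_mul_eq_mul_div, lt_div_iff₀ hε2', ← Nat.cast_lt (α := ℝ)]
    push_cast
    rfl
  have hdom : (ChannelCoding.findCode code lh proj
      (cH ::ᵥ cR ::ᵥ cε ::ᵥ List.Vector.nil)).Dom := by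
    obtain ⟨n, hn, C, hC⟩ := ChannelCoding.exists_blockCode_lt (N := N) hM H (R := (R : ℝ))
      (ε := (ε : ℝ)) (by exact_mod_cast hR) hRC (by exact_mod_cast hε)
    obtain ⟨f, k, hfk⟩ := C.exists_errorBound_lt hproj hc hC
    have hceil := (ChannelCoding.ceil_two_rpow_eq_iff (n := n) (a := proj cR 1) hR2).1
      (by rw [← hReq])
    refine ChannelCoding.findCode_dom (f := f) (k := k) (n := n) (u := C.number code)
      ⟨hn, ?_, ?_, ?_, ?_⟩
    · change ChannelCoding.IsBlockCodeNumber code lh proj (lh cH) (lh (proj cH 0)) n _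
      rw [hlM, hlN]
      exact C.isBlockCodeNumber hlh hproj
    · rw [C.lh_proj_number_zero hlh hproj]
      exact hceil.1
    · rw [C.lh_proj_number_zero hlh hproj]
      exact hceil.2
    · rw [C.lh_proj_number_zero hlh hproj]
      intro w hw
      refine (hcmp _ _).2 ?_
      change ((ChannelCoding.errorBound lh proj cH f k n (C.number code)
        (⟨w, hw⟩ : Fin _) : ℕ) : ℝ) < _
      rw [hcH, C.errorBound_eq hlh hproj hM]
      exact hfk ⟨w, hw⟩
  -- The code found may differ from Shannon's, so its properties are derived from the test alone.
  obtain ⟨u, hu⟩ := Part.dom_iff_mem.1 hdom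
  obtain ⟨f, k, n, hn, hnum, hle, hlt, herr⟩ :
      ∃ f k n, ChannelCoding.IsGood code lh proj cH cR cε f k n u :=
    ChannelCoding.exists_isGood_of_mem_findCode hu
  rw [hlM, hlN] at hnum
  obtain ⟨C, hC⟩ := ChannelCoding.BlockCode.exists_number_eq hlh hproj hnum
  have hceil := (ChannelCoding.ceil_two_rpow_eq_iff (n := n) hR2).2 ⟨hle, hlt⟩
  rw [← hReq] at hceil
  refine ⟨n, _, C, hn, hceil.symm, by rwa [hC], ?_, ?_⟩
  · have hx : (0 : ℝ) < 2 ^ ((n : ℝ) * (R : ℝ)) := by positivity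
    rw [ChannelCoding.BlockCode.rate, le_div_iff₀ (Nat.cast_pos.2 hn), mul_comm, ← hceil]
    rw [Real.le_logb_iff_rpow_le one_lt_two (Nat.cast_pos.2 (Nat.ceil_pos.2 hx))]
    exact Nat.le_ceil _
  · have hm : 0 < lh (proj u 0) := hceil ▸ Nat.ceil_pos.2 (by positivity)
    have : Nonempty (Fin (lh (proj u 0))) := ⟨⟨0, hm⟩⟩
    -- The maximum is attained, so the strict bound for each message passes to it.
    obtain ⟨w, hw⟩ := exists_eq_ciSup_of_finite (f := C.blockError H)
    rw [ChannelCoding.BlockCode.maxBlockError, ← hw]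
    have h1 := C.blockError_le hproj hc f k w
    have h2 := (hcmp _ _).1 (herr w w.2)
    rw [← C.errorBound_eq hlh hproj hM, hC] at h1
    exact lt_of_mul_lt_mul_right (h1.trans_lt h2) (by positivity)
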